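/- Theorem 3.1. Let $H$ be a separable real or complex Hilbert space and let $\mathfrak g_\infty\subset B(H)$ be a real linear subspace with an inner product $(\cdot,\cdot)$ for which it is a Hilbert space; let $|\cdot|$ be the corresponding norm. Assume that the inclusion of $(\mathfrak g_\infty,|\cdot|)$ into $B(H)$ with the operator norm is continuous, that $\mathfrak g_\infty$ is closed under the commutator $[x,y]=xy-yx$, and that there is $C>0$ with $|[x,y]|\le C|x||y|$ for all $x,y\in\mathfrak g_\infty$. Let $C^1_{CM}$ be the set of operator-norm continuous paths $g:[0,1]\to GL(H)$ that are differentiable in $B(H)$ outside a finite set, with $g^{-1}\dot g\in\mathfrak g_\infty$ piecewise continuous for $|\cdot|$ (so that $\dot g$ is piecewise continuous in the operator norm). Let $d(y,z)=\inf_g\int_0^1|g^{-1}\dot g|\,ds$ over the $g\in C^1_{CM}$ with $g(0)=y$, $g(1)=z$ ($d(y,z)=\infty$ if there are none), and let the Cameron–Martin group $G_{CM}=\{x\in GL(H): d(x,I)<\infty\}$ carry the topology of $d$. Its tangent space at $g$ is $g\,\mathfrak g_\infty$, identified with $\mathfrak g_\infty$ by left translation. Then the exponential map $\exp(x)=\sum_{n\ge0}x^n/n!$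 is a diffeomorphism from a neighborhood of $0$ in $\mathfrak g_\infty$ onto a neighborhood of $I$ in $G_{CM}$. That is, there are an open $U\ni 0$ in $(\mathfrak g_\infty,|\cdot|)$ and an open $V\ni I$ in $(G_{CM},d)$ such that $\exp$ restricts to a homeomorphism $U\to V$ for which both of the following hold. 1. $\exp$ is smooth on $U$: there is a $C^\infty$ map $\omega$ from $U$ to the bounded linear operators on $(\mathfrak g_\infty,|\cdot|)$ (with the operator norm belonging to $|\cdot|$) such that $\exp$, as a map to $B(H)$, has at each $x\in U$ the Fréchet derivative $v\mapsto e^{x}\,\omega(x)v$. 2. The inverse $\log:V\to U$ is $C^n$ for every $n$. Here a map $\varphi$ from $V$ to a normed space $F$ is $C^0$ if it is continuous, and it is $C^{n+1}$ if it is continuous and there is a $C^n$ map $L$ from $V$ to the bounded linear maps $\mathfrak g_\infty\to F$ such that $\frac{d}{dt}\varphi(\gamma(t))=L(\gamma(t))\big(\gamma(t)^{-1}\dot\gamma(t)\big)$ whenever $\gamma(t)\in V$, for every curve $\gamma:\mathbb R\to G_{CM}$ that is differentiable in $B(H)$ with $\gamma^{-1}\dot\gamma$ continuous into $(\mathfrak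 g_\infty,|\cdot|)$. -/

import Mathlib

open Set Filter Topology MeasureTheory
open scoped ENNReal

noncomputable section

/-- Bounded operators on a real or complex Hilbert space, as a normed algebra over the reals. -/
instance realNormedAlgebra {𝕜 : Type*} [RCLike 𝕜] {H : Type*} [NormedAddCommGroup H]
    [InnerProductSpace 𝕜 H] : NormedAlgebra ℝ (H →L[𝕜] H) :=
  NormedAlgebra.restrictScalars ℝ 𝕜 (H →L[𝕜] H)

namespace CameronMartin

universe u v

/-- Piecewise continuity on `[0,1]`: continuity off a finite set, and finite one-sided limits at
every point. -/
def PiecewiseContinuous {X : Type*} [TopologicalSpace X] (f : ℝ → X) : Prop :=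
  (∃ S : Finset ℝ, ∀ t ∈ Icc (0 : ℝ) 1, t ∉ S → ContinuousWithinAt f (Icc 0 1) t) ∧
  (∀ t ∈ Ico (0 : ℝ) 1, ∃ l, Tendsto f (𝓝[>] t) (𝓝 l)) ∧
  (∀ t ∈ Ioc (0 : ℝ) 1, ∃ l, Tendsto f (𝓝[<] t) (𝓝 l))

variable {A : Type v} [NormedRing A] [NormedAlgebra ℝ A]
  {E : Type u} [NormedAddCommGroup E] [NormedSpace ℝ E]

/- Here `A` is the algebra of bounded operators, `Aˣ` the group of its invertible elements, and
`ι : E → A` the inclusion of the Hilbert Lie algebra `E` into `A`; the norm of `E` is its own one,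
not the operator norm. -/

/-- `g`, restricted to `[0,1]`, is a path of class `C¹_CM` and `a = g⁻¹ ġ`: the path `g` is
continuous in the norm of `A`, it is differentiable in `A` off a finite set with `g⁻¹ ġ = ι a`, where
`a` is piecewise continuous for the norm of `E`. (Since `ι` will be continuous, `ġ = g (ι a)` is
then piecewise continuous in the norm of `A`.) -/
structure IsCMPath (ι : E →L[ℝ] A) (g : ℝ → Aˣ) (a : ℝ → E) : Prop where
  continuousOn : ContinuousOn (fun t => (g t : A)) (Icc 0 1)
  hasDeriv : ∃ S : Finset ℝ, ∀ t ∈ Icc (0 : ℝ) 1, t ∉ S →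
    HasDerivWithinAt (fun s => (g s : A)) ((g t : A) * ι (a t)) (Icc 0 1) t
  piecewise : PiecewiseContinuous a

/-- The left-invariant distance: the infimum of the lengths `∫₀¹ |g⁻¹ ġ| ds` of the `C¹_CM` paths
from `y` to `z`, and `∞` if there is none. -/
def cmDist (ι : E →L[ℝ] A) (y z : Aˣ) : ℝ≥0∞ :=
  ⨅ (g : ℝ → Aˣ) (a : ℝ → E) (_ : IsCMPath ι g a ∧ g 0 = y ∧ g 1 = z),
    ∫⁻ t in Icc (0 : ℝ) 1, ‖a t‖ₑ

/-- The Cameron–Martin group, the set of all invertible elements at finite distance from `1`. -/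
def GCM (ι : E →L[ℝ] A) : Type v := {x : Aˣ // cmDist ι x 1 < ⊤}

/-- The topology of the metric `cmDist`: a set is open if and only if it contains a ball about each
of its points. -/
instance (ι : E →L[ℝ] A) : TopologicalSpace (GCM ι) where
  IsOpen U := ∀ x ∈ U, ∃ ε : ℝ≥0∞, 0 < ε ∧ ∀ y : GCM ι, cmDist ι x.1 y.1 < ε → y ∈ U
  isOpen_univ := fun _ _ => ⟨1, one_pos, fun _ _ => trivial⟩
  isOpen_inter := by
    intro s t hs ht x hx
    obtain ⟨ε, hε, h⟩ := hs x hx.1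
    obtain ⟨δ, hδ, h'⟩ := ht x hx.2
    exact ⟨min ε δ, lt_min hε hδ, fun y hy =>
      ⟨h y (hy.trans_le (min_le_left _ _)), h' y (hy.trans_le (min_le_right _ _))⟩⟩
  isOpen_sUnion := by
    intro s hs x hx
    obtain ⟨t, ht, hxt⟩ := hx
    obtain ⟨ε, hε, h⟩ := hs t ht x hxt
    exact ⟨ε, hε, fun y hy => ⟨t, ht, h y hy⟩⟩

section Exp

variable [CompleteSpace A]

lemma exp_mul_exp_neg (x : A) : NormedSpace.exp x * NormedSpace.exp (-x) = 1 := by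
  let _ : NormedAlgebra ℚ A := NormedAlgebra.restrictScalars ℚ ℝ A
  rw [← NormedSpace.exp_add_of_commute (Commute.neg_right (Commute.refl x)), add_neg_cancel,
    NormedSpace.exp_zero]

/-- The exponential of an element of `A`, as an invertible element. -/
def expUnit (x : A) : Aˣ where
  val := NormedSpace.exp x
  inv := NormedSpace.exp (-x)
  val_inv := exp_mul_exp_neg x
  inv_val := by simpa using exp_mul_exp_neg (-x)

lemma isCMPath_exp (ι : E →L[ℝ] A) (x : E) :
    IsCMPath ι (fun t => expUnit ((1 - t) • ι x)) (fun _ => -x) := by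
  have key : ∀ t : ℝ, HasDerivAt (fun s : ℝ => NormedSpace.exp ((1 - s) • ι x))
      (NormedSpace.exp ((1 - t) • ι x) * ι (-x)) t := by
    intro t
    have h1 := hasDerivAt_exp_smul_const (𝕂 := ℝ) (ι x) (1 - t)
    have h2 : HasDerivAt (fun s : ℝ => 1 - s) (-1) t := by
      simpa using (hasDerivAt_id t).const_sub 1
    have h3 := h1.scomp t h2
    simpa [Function.comp_def] using h3
  refine ⟨fun t _ => (key t).continuousAt.continuousWithinAt, ⟨∅, fun t _ _ =>
    (key t).hasDerivWithinAt⟩, ⟨∅, fun t _ _ => continuousWithinAt_const⟩, ?_, ?_⟩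
  · exact fun t _ => ⟨-x, tendsto_const_nhds⟩
  · exact fun t _ => ⟨-x, tendsto_const_nhds⟩

lemma cmDist_exp_lt_top (ι : E →L[ℝ] A) (x : E) : cmDist ι (expUnit (ι x)) 1 < ⊤ := by
  refine lt_of_le_of_lt (iInf_le_of_le _ (iInf_le_of_le _ (iInf_le_of_le
    ⟨isCMPath_exp ι x, by simp, ?_⟩ le_rfl))) ?_
  · ext
    simp [expUnit]
  · simp

/-- The exponential map from the Lie algebra to the Cameron–Martin group, `x ↦ ∑ xⁿ / n!`. -/
def expCM (ι : E →L[ℝ] A) (x : E) : GCM ι := ⟨expUnit (ι x), cmDist_exp_lt_top ι x⟩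

end Exp

/- The tangent space of the Cameron–Martin group at `g` consists of the elements `g * ι v` of `A`,
`v ∈ E`, and is identified with `E` by left translation, exactly as for paths of class `C¹_CM`.
Below, derivatives of maps into the group have values in `E`, and derivatives of maps defined on
the group are linear on `E`, through this identification. -/

/-- A map `f` from an open subset `U` of a normed space to the Cameron–Martin group is smooth if it
is continuous and there is a smooth `ω` on `U`, with values bounded linear maps into `E` (for the
operator norm that belongs to the norm of `E`), such that `f`, as a map to `A`, has the derivative
`v ↦ f x * ι (ω x v)` at each `x ∈ U`. -/
def SmoothInto (ι : E →L[ℝ] A) {F : Type*} [NormedAddCommGroup F] [NormedSpace ℝ F]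
    (f : F → GCM ι) (U : Set F) : Prop :=
  ContinuousOn f U ∧ ∃ ω : F → F →L[ℝ] E, ContDiffOn ℝ ((⊤ : ℕ∞) : WithTop ℕ∞) ω U ∧
    ∀ x ∈ U, HasFDerivAt (fun y => ((f y).1 : A))
      ((ContinuousLinearMap.mul ℝ A ((f x).1 : A)).comp (ι.comp (ω x))) x

/-- `γ` is a `C¹` curve in the Cameron–Martin group with left derivative `γ⁻¹ γ' = ι a`. -/
def IsC1Curve (ι : E →L[ℝ] A) (γ : ℝ → GCM ι) (a : ℝ → E) : Prop :=
  Continuous a ∧ ∀ t, HasDerivAt (fun s => ((γ s).1 : A)) (((γ t).1 : A) * ι (a t)) t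

/-- `L g : E → F` is the differential of `φ` at `g`, for each `g` in the open set `V`: along each
`C¹` curve `γ`, the derivative of `φ ∘ γ` is `L γ (γ⁻¹ γ')`. -/
def HasLeftDifferential (ι : E →L[ℝ] A) {F : Type*} [NormedAddCommGroup F] [NormedSpace ℝ F]
    (φ : GCM ι → F) (L : GCM ι → E →L[ℝ] F) (V : Set (GCM ι)) : Prop :=
  ∀ γ a, IsC1Curve ι γ a → ∀ t, γ t ∈ V → HasDerivAt (fun s => φ (γ s)) (L (γ t) (a t)) t

/-- Functions of class `Cⁿ` from the open subset `V` of the Cameron–Martin group to a normed space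
`F`: continuous ones for `n = 0`, and those with a differential of class `Cⁿ⁻¹` (with values in the
space of bounded linear maps from `E` to `F` with its operator norm) for `n ≥ 1`. -/
def ContDiffFrom (ι : E →L[ℝ] A) : (n : ℕ) → {F : Type u} → [NormedAddCommGroup F] →
    [NormedSpace ℝ F] → (GCM ι → F) → Set (GCM ι) → Prop
  | 0, _, _, _, φ, V => ContinuousOn φ V
  | n + 1, F, _, _, φ, V => ContinuousOn φ V ∧
      ∃ L : GCM ι → E →L[ℝ] F, HasLeftDifferential ι φ L V ∧ ContDiffFrom ι n L V

/-- Smooth functions on an open subset of the Cameron–Martin group. -/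
def SmoothFrom (ι : E →L[ℝ] A) {F : Type u} [NormedAddCommGroup F] [NormedSpace ℝ F]
    (φ : GCM ι → F) (V : Set (GCM ι)) : Prop :=
  ∀ n : ℕ, ContDiffFrom ι n φ V

end CameronMartin

end

noncomputable section
namespace CameronMartin
universe u v

/-! ### The exponential in a Banach algebra -/

section Algebra

variable {A : Type v} [NormedRing A] [NormedAlgebra ℝ A] [CompleteSpace A]

/-! The proof compares paths in the group with paths in the Lie algebra. As a map into `A`, `exp ∘
ι` has left logarithmic derivative `ω(x) = (1 - exp(-ad x)) / ad x` (`hasFDerivAt_exp_comp`). This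
is a smooth function of `x` with values in the bounded operators on `E`, because the bracket is
bounded for the norm of `E`. Since `ω(0) = 1`, on a small ball `ω(x)` is invertible, it and its
inverse are bounded, and the inverse is Lipschitz and smooth (`exists_isExpChart`).

The inverse function theorem is used only in `A`, for injectivity; the topology of the group is
finer than a norm topology and is handled through paths. If `g` has `g⁻¹ ġ = a` and starts at `exp
x₀`, solve `x' = ω(x)⁻¹ a` with `x(0) = x₀`. Then `exp x` and `g` have the same left derivative and
the same start, so `exp (x(t)) g(t)⁻¹` is constant and `g = exp x` (`exists_lift`). A path of length
at most `δ` thus lifts to one that moves by at most `N δ`, so `exp` is open. Conversely, the image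
of a segment has length at most `N ‖y - x‖` (`cmDist_exp_le`), so `exp` is continuous. Together
these make `exp` a homeomorphism onto an open set.

The lift also satisfies `x(1) = x₀ + ω(x₀)⁻¹ ∫ a + O(δ²)`. Applied to short pieces of a `C¹` curve,
this shows that `log` has differential `ω(log g)⁻¹`. That is a smooth function of `log g`, so
induction gives every order of differentiability. -/

lemma contDiff_exp : ContDiff ℝ ((⊤ : ℕ∞) : WithTop ℕ∞) (NormedSpace.exp : A → A) :=
  contDiff_iff_contDiffAt.2 fun x => (NormedSpace.exp_analytic (𝕂 := ℝ) x).contDiffAt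

lemma continuous_exp : Continuous (NormedSpace.exp : A → A) := contDiff_exp.continuous

lemma exp_neg_mul_exp (x : A) : NormedSpace.exp (-x) * NormedSpace.exp x = 1 := by
  simpa using exp_mul_exp_neg (-x)

lemma hasDerivAt_exp_smul (x : A) (t : ℝ) :
    HasDerivAt (fun s : ℝ => NormedSpace.exp (s • x)) (NormedSpace.exp (t • x) * x) t :=
  hasDerivAt_exp_smul_const (𝕂 := ℝ) x t

lemma hasDerivAt_exp_smul' (x : A) (t : ℝ) :
    HasDerivAt (fun s : ℝ => NormedSpace.exp (s • x)) (x * NormedSpace.exp (t • x)) t :=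
  hasDerivAt_exp_smul_const' (𝕂 := ℝ) x t

lemma hasDerivAt_exp_neg_smul (x : A) (t : ℝ) :
    HasDerivAt (fun s : ℝ => NormedSpace.exp (-(s • x))) (-(NormedSpace.exp (-(t • x)) * x)) t := by
  simpa using hasDerivAt_exp_smul (-x) t

/-- A continuous map on an interval with zero derivative off a countable set takes the same value at
both ends. -/
lemma eq_of_hasDerivAt_zero_off_countable {F : Type*} [NormedAddCommGroup F] [NormedSpace ℝ F]
    [CompleteSpace F] {f : ℝ → F} {S : Set ℝ} (hS : S.Countable)
    (hc : ContinuousOn f (Icc 0 1)) (hd : ∀ t ∈ Ioo (0 : ℝ) 1 \ S, HasDerivAt f 0 t) :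
    f 1 = f 0 := by
  have := integral_eq_of_hasDerivAt_off_countable_of_le f (fun _ => (0 : F)) zero_le_one hS hc hd
    (by simp)
  exact sub_eq_zero.1 (by simpa using this.symm)

end Algebra

/-! ### The logarithmic derivative of the exponential map -/

section Omega

variable {E : Type u} [NormedAddCommGroup E] [NormedSpace ℝ E]

/-- The operator `(u, v) ↦ (v - [x, u], 0)` on `E × E`. The upper row of its exponential consists of
`exp (-ad x)` and `(1 - exp (-ad x)) / ad x`. -/
def adBlock (B : E →L[ℝ] E →L[ℝ] E) (x : E) : E × E →L[ℝ] E × E :=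
  (ContinuousLinearMap.inl ℝ E E).comp
    (ContinuousLinearMap.snd ℝ E E - (B x).comp (ContinuousLinearMap.fst ℝ E E))

lemma adBlock_apply (B : E →L[ℝ] E →L[ℝ] E) (x : E) (p : E × E) :
    adBlock B x p = (p.2 - B x p.1, 0) := by
  simp [adBlock]

lemma contDiff_adBlock (B : E →L[ℝ] E →L[ℝ] E) :
    ContDiff ℝ ((⊤ : ℕ∞) : WithTop ℕ∞) (adBlock B) := by
  unfold adBlock
  fun_prop

/-- The function `(1 - exp (-ad x)) / ad x`, which is the logarithmic derivative of the
exponential map. -/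
def omega (B : E →L[ℝ] E →L[ℝ] E) (x : E) : E →L[ℝ] E :=
  (ContinuousLinearMap.fst ℝ E E).comp
    ((NormedSpace.exp (adBlock B x)).comp (ContinuousLinearMap.inr ℝ E E))

variable [CompleteSpace E]

lemma contDiff_omega (B : E →L[ℝ] E →L[ℝ] E) :
    ContDiff ℝ ((⊤ : ℕ∞) : WithTop ℕ∞) (omega B) := by
  have := contDiff_exp.comp (contDiff_adBlock B)
  exact contDiff_const.clm_comp (this.clm_comp contDiff_const)

/-- With the generator on the right, the derivative of the orbit of `(0, v)` is the orbit of
`adBlock B x (0, v) = (v, 0)`, which links `ω` to `exp (-ad x)`. The version below, with the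
generator on the left, says that the orbit solves a linear differential equation. -/
lemma hasDerivAt_exp_adBlock_apply (B : E →L[ℝ] E →L[ℝ] E) (x : E) (p : E × E) (t : ℝ) :
    HasDerivAt (fun s : ℝ => NormedSpace.exp (s • adBlock B x) p)
      (NormedSpace.exp (t • adBlock B x) (adBlock B x p)) t := by
  simpa using (hasDerivAt_exp_smul (adBlock B x) t).clm_apply (hasDerivAt_const t p)

lemma hasDerivAt_exp_adBlock_apply' (B : E →L[ℝ] E →L[ℝ] E) (x : E) (p : E × E) (t : ℝ) :
    HasDerivAt (fun s : ℝ => NormedSpace.exp (s • adBlock B x) p)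
      (adBlock B x (NormedSpace.exp (t • adBlock B x) p)) t := by
  simpa using (hasDerivAt_exp_smul' (adBlock B x) t).clm_apply (hasDerivAt_const t p)

/-- `adBlock` takes values in `E × 0`, so the second component of an orbit has zero derivative. The
first component `u` therefore solves `u' = p.2 - [x, u]`. -/
lemma exp_adBlock_apply_snd (B : E →L[ℝ] E →L[ℝ] E) (x : E) (p : E × E) (t : ℝ) :
    (NormedSpace.exp (t • adBlock B x) p).2 = p.2 := by
  have hd : ∀ s : ℝ, HasDerivAt (fun s : ℝ => (NormedSpace.exp (s • adBlock B x) p).2) 0 s := by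
    intro s
    have h := (hasFDerivAt_snd (𝕜 := ℝ)).comp_hasDerivAt s (hasDerivAt_exp_adBlock_apply' B x p s)
    simpa [adBlock_apply, Function.comp_def] using h
  have := is_const_of_deriv_eq_zero (fun s => (hd s).differentiableAt) (fun s => (hd s).deriv) t 0
  simpa [NormedSpace.exp_zero] using this

lemma omega_zero (B : E →L[ℝ] E →L[ℝ] E) : omega B 0 = 1 := by
  ext v
  have hd : ∀ s : ℝ, HasDerivAt
      (fun s : ℝ => (NormedSpace.exp (s • adBlock B 0) (0, v)).1 - s • v) 0 s := by
    intro s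
    have h := ((hasFDerivAt_fst (𝕜 := ℝ)).comp_hasDerivAt s
      (hasDerivAt_exp_adBlock_apply' B 0 (0, v) s)).fun_sub ((hasDerivAt_id s).smul_const v)
    simpa [adBlock_apply, Function.comp_def, exp_adBlock_apply_snd] using h
  have := is_const_of_deriv_eq_zero (fun s => (hd s).differentiableAt) (fun s => (hd s).deriv) 1 0
  simpa [NormedSpace.exp_zero, omega, sub_eq_zero] using this

variable {A : Type v} [NormedRing A] [NormedAlgebra ℝ A] [CompleteSpace A]

/-- `exp (-ad x)` is conjugation by `exp (-x)`. -/
lemma exp_neg_mul_mul_exp (ι : E →L[ℝ] A) (B : E →L[ℝ] E →L[ℝ] E)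
    (hB : ∀ x y, ι (B x y) = ι x * ι y - ι y * ι x) (x v : E) (t : ℝ) :
    NormedSpace.exp (-(t • ι x)) * ι v * NormedSpace.exp (t • ι x) =
      ι (NormedSpace.exp (t • adBlock B x) (v, 0)).1 := by
  -- `P` solves `P' = -[x, P]` with `P 0 = v`, so conjugating `ι (P s)` by `exp (s • ι x)` gives a
  -- constant.
  set P : ℝ → E := fun s => (NormedSpace.exp (s • adBlock B x) (v, 0)).1 with hP
  have hPd : ∀ s : ℝ, HasDerivAt (fun s => ι (P s)) (-(ι x * ι (P s) - ι (P s) * ι x)) s := by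
    intro s
    have h := (hasFDerivAt_fst (𝕜 := ℝ)).comp_hasDerivAt s
      (hasDerivAt_exp_adBlock_apply' B x (v, 0) s)
    have h' := ι.hasFDerivAt.comp_hasDerivAt s h
    simpa [adBlock_apply, Function.comp_def, exp_adBlock_apply_snd, hB, hP] using h'
  have hd : ∀ s : ℝ, HasDerivAt
      (fun s => NormedSpace.exp (s • ι x) * ι (P s) * NormedSpace.exp (-(s • ι x))) 0 s := by
    intro s
    refine (((hasDerivAt_exp_smul (ι x) s).fun_mul (hPd s)).fun_mul
      (hasDerivAt_exp_neg_smul (ι x) s)).congr_deriv ?_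
    -- `ι x` commutes with its exponential: the two formulas for the derivative of `exp (-(s • ι
    -- x))` must agree.
    have hc : NormedSpace.exp (-(s • ι x)) * ι x = ι x * NormedSpace.exp (-(s • ι x)) :=
      (hasDerivAt_exp_neg_smul (ι x) s).neg.unique
        (by simpa using (hasDerivAt_exp_smul' (-ι x) s).neg) |>.symm ▸ by simp
    rw [hc]
    noncomm_ring
  have h := is_const_of_deriv_eq_zero (fun s => (hd s).differentiableAt) (fun s => (hd s).deriv) t 0
  simp only [zero_smul, NormedSpace.exp_zero, neg_zero, one_mul, mul_one] at h
  have h0 : P 0 = v := by simp [hP, NormedSpace.exp_zero]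
  rw [h0] at h
  change _ = ι (P t)
  rw [← h]
  simp only [mul_assoc, exp_neg_mul_exp, mul_one]
  rw [← mul_assoc, exp_neg_mul_exp, one_mul]

/-- The derivative of the exponential map. -/
lemma hasFDerivAt_exp_comp (ι : E →L[ℝ] A) (B : E →L[ℝ] E →L[ℝ] E)
    (hB : ∀ x y, ι (B x y) = ι x * ι y - ι y * ι x) (x : E) :
    HasFDerivAt (fun y => NormedSpace.exp (ι y))
      ((ContinuousLinearMap.mul ℝ A (NormedSpace.exp (ι x))).comp (ι.comp (omega B x))) x := by
  obtain ⟨K, hK⟩ : ∃ K, ∀ t ∈ Icc (0 : ℝ) 1, ‖NormedSpace.exp (-(t • ι x))‖ ≤ K :=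
    isCompact_Icc.exists_bound_of_continuousOn
      (continuous_exp.comp (by fun_prop : Continuous fun t : ℝ => -(t • ι x))).continuousOn
  have hK0 : 0 ≤ K := (norm_nonneg _).trans (hK 0 (by simp))
  rw [hasFDerivAt_iff_isLittleO, Asymptotics.isLittleO_iff]
  intro c hc
  -- The `+ 1` in the denominator of the witness avoids division by zero when the product of norms
  -- vanishes.
  obtain ⟨ε, hε, hεc⟩ : ∃ ε > 0, ‖NormedSpace.exp (ι x)‖ * (K * ‖ι‖ * ε) ≤ c := by
    refine ⟨c / (‖NormedSpace.exp (ι x)‖ * (K * ‖ι‖) + 1), by positivity, ?_⟩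
    rw [← mul_assoc, ← mul_div_assoc, div_le_iff₀ (by positivity)]
    nlinarith
  have hu : ∀ᶠ y in 𝓝 x, ∀ t ∈ Icc (0 : ℝ) 1,
      ‖NormedSpace.exp (t • ι y) - NormedSpace.exp (t • ι x)‖ < ε := by
    refine isCompact_Icc.eventually_forall_of_forall_eventually fun t _ => ?_
    have hcont : Continuous fun z : E × ℝ =>
        ‖NormedSpace.exp (z.2 • ι z.1) - NormedSpace.exp (z.2 • ι x)‖ :=
      ((continuous_exp.comp (by fun_prop)).sub (continuous_exp.comp (by fun_prop))).norm
    exact hcont.continuousAt.eventually_lt continuousAt_const (by simpa using hε)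
  filter_upwards [hu] with y hy
  set v := y - x with hv
  -- Duhamel's argument: the first term of `f` has derivative `exp(-t x) v exp(t y)` and the second
  -- `exp(-t x) v exp(t x)`. So `f'` is `‖v‖` times a factor that is small uniformly in `t`, and
  -- `exp (ι x) * (f 1 - f 0)` is the remainder of the expansion of `exp` at `x`.
  set f : ℝ → A := fun t => NormedSpace.exp (-(t • ι x)) * NormedSpace.exp (t • ι y) -
    ι (NormedSpace.exp (t • adBlock B x) (0, v)).1 with hf
  have hfd : ∀ t, HasDerivAt f (NormedSpace.exp (-(t • ι x)) * ι v *
      (NormedSpace.exp (t • ι y) - NormedSpace.exp (t • ι x))) t := by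
    intro t
    have h := ι.hasFDerivAt.comp_hasDerivAt t ((hasFDerivAt_fst (𝕜 := ℝ)).comp_hasDerivAt t
      (hasDerivAt_exp_adBlock_apply B x (0, v) t))
    have h2 := ((hasDerivAt_exp_neg_smul (ι x) t).fun_mul (hasDerivAt_exp_smul' (ι y) t)).fun_sub h
    refine h2.congr_deriv ?_
    have h3 := exp_neg_mul_mul_exp ι B hB x v t
    have h4 : adBlock B x (0, v) = (v, 0) := by simp [adBlock_apply]
    simp only [h4, ContinuousLinearMap.coe_fst', mul_sub]
    rw [h3, ← h3, hv, map_sub]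
    noncomm_ring
  have hmv := norm_image_sub_le_of_norm_deriv_le_segment_01' (f := f) (C := K * ‖ι‖ * ε * ‖v‖)
    (fun t _ => (hfd t).hasDerivWithinAt) (fun t ht => by
      have ht' := Ico_subset_Icc_self ht
      calc _ ≤ ‖NormedSpace.exp (-(t • ι x))‖ * ‖ι v‖ *
            ‖NormedSpace.exp (t • ι y) - NormedSpace.exp (t • ι x)‖ :=
            (norm_mul_le _ _).trans (by gcongr; exact norm_mul_le _ _)
        _ ≤ K * (‖ι‖ * ‖v‖) * ε := by
            gcongr
            · exact hK t ht'
            · exact ι.le_opNorm v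
            · exact (hy t ht').le
        _ = _ := by ring)
  have hfin : NormedSpace.exp (ι y) - NormedSpace.exp (ι x) -
      ((ContinuousLinearMap.mul ℝ A (NormedSpace.exp (ι x))).comp (ι.comp (omega B x))) v =
      NormedSpace.exp (ι x) * (f 1 - f 0) := by
    have : NormedSpace.exp (ι x) * (NormedSpace.exp (-ι x) * NormedSpace.exp (ι y)) =
        NormedSpace.exp (ι y) := by rw [← mul_assoc, exp_mul_exp_neg, one_mul]
    simp [hf, omega, NormedSpace.exp_zero, mul_sub, this]
    abel
  rw [hfin]
  calc _ ≤ ‖NormedSpace.exp (ι x)‖ * ‖f 1 - f 0‖ := norm_mul_le _ _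
    _ ≤ ‖NormedSpace.exp (ι x)‖ * (K * ‖ι‖ * ε * ‖v‖) := by gcongr
    _ = ‖NormedSpace.exp (ι x)‖ * (K * ‖ι‖ * ε) * ‖v‖ := by ring
    _ ≤ c * ‖v‖ := by gcongr

end Omega

/-! ### Picard iteration with an integrable driving term -/

section ODE

variable {E : Type u} [NormedAddCommGroup E] [NormedSpace ℝ E] [CompleteSpace E]

/-- Solutions of `x' = ψ(x) a` for an integrable `a`, in integral form, as long as the integral of
`‖a‖` is small compared with the bounds on `ψ`. -/
lemma exists_integral_curve {ψ : E → E →L[ℝ] E} {r N δ : ℝ} {K : NNReal}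
    (hN : ∀ x ∈ Metric.ball (0 : E) r, ‖ψ x‖ ≤ N)
    (hK : LipschitzOnWith K ψ (Metric.ball 0 r)) {a : ℝ → E} (ha : Integrable a)
    (hδ : ∫ t, ‖a t‖ ≤ δ) (hN0 : 0 ≤ N) {x₀ : E} (hx₀ : ‖x₀‖ + N * δ < r) (hKδ : K * δ < 1) :
    ∃ x : ℝ → E, Continuous x ∧ (∀ t, ‖x t - x₀‖ ≤ N * δ) ∧
      Integrable (fun s => ψ (x s) (a s)) ∧ ∀ t, x t = x₀ + ∫ s in (0 : ℝ)..t, ψ (x s) (a s) := by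
  have hδ0 : 0 ≤ δ := (integral_nonneg fun _ => norm_nonneg _).trans hδ
  have hNδ : 0 ≤ N * δ := by positivity
  -- As `a` is integrable on the whole line, the Picard map acts on bounded continuous functions on
  -- `ℝ`. The closed ball of radius `N δ` about the constant `x₀` is complete and, by `hx₀`,
  -- consists of functions with values in the ball where `ψ` is controlled.
  set X := Metric.closedBall (BoundedContinuousFunction.const ℝ x₀) (N * δ) with hX
  have hX' : ∀ x : BoundedContinuousFunction ℝ E, x ∈ X ↔ ∀ t, ‖x t - x₀‖ ≤ N * δ := by
    intro x
    rw [hX, Metric.mem_closedBall, BoundedContinuousFunction.dist_le hNδ]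
    simp [dist_eq_norm]
  have hball : ∀ x ∈ X, ∀ t, x t ∈ Metric.ball (0 : E) r := by
    intro x hx t
    rw [mem_ball_zero_iff]
    have h1 := (hX' x).1 hx t
    have h2 := norm_add_le (x t - x₀) x₀
    rw [sub_add_cancel] at h2
    linarith
  have hmeas : ∀ x ∈ X, AEStronglyMeasurable (fun s => ψ (x s) (a s)) := by
    intro x hx
    have hc : Continuous fun s => ψ (x s) :=
      hK.continuousOn.comp_continuous x.continuous (hball x hx)
    exact (ContinuousLinearMap.id ℝ (E →L[ℝ] E)).aestronglyMeasurable_comp₂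
      hc.aestronglyMeasurable ha.aestronglyMeasurable
  have hle : ∀ x ∈ X, ∀ s, ‖ψ (x s) (a s)‖ ≤ N * ‖a s‖ := fun x hx s =>
    (ψ (x s)).le_of_opNorm_le (hN _ (hball x hx s)) _
  have hint : ∀ x ∈ X, Integrable fun s => ψ (x s) (a s) := fun x hx =>
    (ha.norm.const_mul N).mono' (hmeas x hx) (Eventually.of_forall (hle x hx))
  -- Used with `c = N` to see that the ball is preserved, and with `c = K * dist x y` for the
  -- contraction estimate.
  have hbound : ∀ (f : ℝ → E) (c : ℝ), 0 ≤ c → (∀ s, ‖f s‖ ≤ c * ‖a s‖) → ∀ t : ℝ,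
      ‖∫ s in (0 : ℝ)..t, f s‖ ≤ c * δ := by
    intro f c hc hf t
    refine intervalIntegral.norm_integral_le_integral_norm_uIoc.trans ?_
    calc _ ≤ ∫ s in uIoc 0 t, c * ‖a s‖ :=
          integral_mono_of_nonneg (Eventually.of_forall fun _ => norm_nonneg _)
            (ha.norm.const_mul c).restrict (Eventually.of_forall hf)
      _ ≤ ∫ s, c * ‖a s‖ := setIntegral_le_integral (ha.norm.const_mul c)
            (Eventually.of_forall fun _ => by positivity)
      _ ≤ c * δ := by rw [integral_const_mul]; gcongr
  have hcont : ∀ x ∈ X, Continuous fun t => x₀ + ∫ s in (0 : ℝ)..t, ψ (x s) (a s) := fun x hx =>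
    continuous_const.add (intervalIntegral.continuous_primitive
      (fun _ _ => (hint x hx).intervalIntegrable) 0)
  let G : X → BoundedContinuousFunction ℝ E := fun x =>
    BoundedContinuousFunction.ofNormedAddCommGroup
      (fun t => x₀ + ∫ s in (0 : ℝ)..t, ψ (x.1 s) (a s)) (hcont x.1 x.2) (‖x₀‖ + N * δ) fun t =>
        (norm_add_le _ _).trans (by gcongr; exact hbound _ N hN0 (hle x.1 x.2) t)
  have hG : ∀ x t, G x t = x₀ + ∫ s in (0 : ℝ)..t, ψ (x.1 s) (a s) := fun _ _ => rfl
  let F : X → X := fun x => ⟨G x, (hX' _).2 fun t => by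
    rw [hG, add_sub_cancel_left]; exact hbound _ N hN0 (hle x.1 x.2) t⟩
  have hF : ContractingWith (K * δ.toNNReal) F := by
    refine ⟨?_, LipschitzWith.of_dist_le_mul fun x y => ?_⟩
    · rw [← NNReal.coe_lt_coe]
      simpa [hδ0] using hKδ
    · rw [Subtype.dist_eq, BoundedContinuousFunction.dist_le (by positivity)]
      intro t
      change dist (G x t) (G y t) ≤ _
      rw [hG, hG, dist_add_left, dist_eq_norm, ← intervalIntegral.integral_sub
        (hint x.1 x.2).intervalIntegrable (hint y.1 y.2).intervalIntegrable]
      refine (hbound _ (K * dist x y) (by positivity) (fun s => ?_) t).trans (le_of_eq ?_)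
      · rw [← _root_.sub_apply]
        refine ContinuousLinearMap.le_of_opNorm_le _ ?_ _
        rw [← dist_eq_norm]
        refine (hK.dist_le_mul _ (hball x.1 x.2 s) _ (hball y.1 y.2 s)).trans ?_
        gcongr
        exact BoundedContinuousFunction.dist_coe_le_dist s
      · simp [hδ0]
        ring
  have : CompleteSpace X := Metric.isClosed_closedBall.completeSpace_coe
  have : Nonempty X := ⟨⟨_, Metric.mem_closedBall_self hNδ⟩⟩
  set x := ContractingWith.fixedPoint F hF with hx
  have hfix : F x = x := hF.fixedPoint_isFixedPt
  refine ⟨x.1, x.1.continuous, (hX' _).1 x.2, hint _ x.2, fun t => ?_⟩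
  rw [← hG, show G x = (F x).1 from rfl, hfix]

end ODE

/-- The finite exceptional set is null, so continuity on the rest of `[0,1]` is enough. -/
lemma PiecewiseContinuous.aestronglyMeasurable {E : Type*} [NormedAddCommGroup E] {a : ℝ → E}
    (ha : PiecewiseContinuous a) :
    AEStronglyMeasurable a (volume.restrict (Icc 0 1)) := by
  obtain ⟨⟨S, hS⟩, -⟩ := ha
  have hc : ContinuousOn a (Icc (0 : ℝ) 1 \ S) := fun t ht => (hS t ht.1 ht.2).mono sdiff_subset
  have hm := hc.aestronglyMeasurable (μ := volume)
    (measurableSet_Icc.diff S.finite_toSet.measurableSet)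
  rwa [Measure.restrict_congr_set (sdiff_null_ae_eq_self (S.finite_toSet.measure_zero volume))] at hm

/-! ### Existence of the chart ball and lifting of paths -/

section Lift

variable {E : Type u} [NormedAddCommGroup E] [NormedSpace ℝ E]
  {A : Type v} [NormedRing A] [NormedAlgebra ℝ A]

/-- The properties of a ball about `0` on which the exponential map is a chart: there
`ω = (1 - exp (-ad x)) / ad x` is invertible, it is bounded together with its inverse, the inverse
is smooth and Lipschitz continuous, and the exponential map is injective. -/
structure IsExpChart (ι : E →L[ℝ] A) (B : E →L[ℝ] E →L[ℝ] E) (r N : ℝ) (K : NNReal) : Prop where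
  bracket : ∀ x y, ι (B x y) = ι x * ι y - ι y * ι x
  radius_pos : 0 < r
  one_le : 1 ≤ N
  lipschitz_radius : K * r < 1
  omega_mul_inverse : ∀ x ∈ Metric.ball (0 : E) r, omega B x * Ring.inverse (omega B x) = 1
  norm_omega_le : ∀ x ∈ Metric.ball (0 : E) r, ‖omega B x‖ ≤ N
  norm_inverse_le : ∀ x ∈ Metric.ball (0 : E) r, ‖Ring.inverse (omega B x)‖ ≤ N
  lipschitz : LipschitzOnWith K (fun x => Ring.inverse (omega B x)) (Metric.ball 0 r)
  contDiffOn : ContDiffOn ℝ ((⊤ : ℕ∞) : WithTop ℕ∞) (fun x => Ring.inverse (omega B x))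
    (Metric.ball 0 r)
  injOn : InjOn (fun x => NormedSpace.exp (ι x)) (Metric.ball 0 r)

variable [CompleteSpace E] [CompleteSpace A]

/-- Everything about `ω` is an open condition at `0`, where `ω = 1`: units are open and inversion is
smooth on them. Injectivity comes from the inverse function theorem for `exp` on `A`, pulled back
along the injective `ι`. -/
lemma exists_isExpChart (ι : E →L[ℝ] A) (hι : Function.Injective ι) (B : E →L[ℝ] E →L[ℝ] E)
    (hB : ∀ x y, ι (B x y) = ι x * ι y - ι y * ι x) :
    ∃ r N K, IsExpChart ι B r N K := by
  have hunit : IsUnit (omega B 0) := by rw [omega_zero]; exact isUnit_one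
  have hsm : ContDiffAt ℝ ((⊤ : ℕ∞) : WithTop ℕ∞) (fun x => Ring.inverse (omega B x)) 0 := by
    obtain ⟨w, hw⟩ := hunit
    have h1 := contDiffAt_ringInverse ℝ (n := ((⊤ : ℕ∞) : WithTop ℕ∞)) w
    rw [hw] at h1
    exact h1.comp (0 : E) (contDiff_omega B).contDiffAt
  have hcω : ContinuousAt (omega B) 0 := (contDiff_omega B).continuous.continuousAt
  have hev : ∀ᶠ x in 𝓝 (0 : E), IsUnit (omega B x) :=
    hcω.eventually (Units.isOpen.mem_nhds hunit)
  have hev2 := hcω.norm.eventually_lt (continuousAt_const (y := ‖omega B 0‖ + 1)) (by simp)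
  have hev3 := hsm.continuousAt.norm.eventually_lt
    (continuousAt_const (y := ‖Ring.inverse (omega B 0)‖ + 1)) (by simp)
  obtain ⟨K, s, hs, hK⟩ := (hsm.of_le (m := 1) (by exact_mod_cast le_top)).exists_lipschitzOnWith
  have hev4 : ∀ᶠ x in 𝓝 (0 : E), ContDiffAt ℝ ((⊤ : ℕ∞) : WithTop ℕ∞)
      (fun x => Ring.inverse (omega B x)) x := by
    filter_upwards [hev] with x hx
    obtain ⟨w, hw⟩ := hx
    have h1 := contDiffAt_ringInverse ℝ (n := ((⊤ : ℕ∞) : WithTop ℕ∞)) w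
    rw [hw] at h1
    exact h1.comp x (contDiff_omega B).contDiffAt
  obtain ⟨W, hW0, hWinj⟩ : ∃ W ∈ 𝓝 (0 : A), InjOn (NormedSpace.exp : A → A) W := by
    have h := (hasStrictFDerivAt_exp_zero (𝕂 := ℝ) (𝔸 := A))
    exact ⟨_, (h.toOpenPartialHomeomorph (f' := ContinuousLinearEquiv.refl ℝ A)).open_source.mem_nhds
      (h.mem_toOpenPartialHomeomorph_source (f' := ContinuousLinearEquiv.refl ℝ A)),
      (h.toOpenPartialHomeomorph (f' := ContinuousLinearEquiv.refl ℝ A)).injOn⟩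
  have hev5 : ∀ᶠ x in 𝓝 (0 : E), ι x ∈ W :=
    ι.continuous.continuousAt.eventually_mem (by simpa using hW0)
  obtain ⟨ρ, hρ, hball⟩ := Metric.eventually_nhds_iff_ball.1
    (hev.and (hev2.and (hev3.and ((hev4.and hev5).and hs))))
  -- The second bound forces `K r < 1`, so that Picard iteration contracts for every path short
  -- enough to stay in the ball.
  set r := min ρ (1 / (K + 1)) with hr
  have hsub : Metric.ball (0 : E) r ⊆ Metric.ball 0 ρ := Metric.ball_subset_ball (min_le_left _ _)
  refine ⟨r, max 1 (max (‖omega B 0‖ + 1) (‖Ring.inverse (omega B 0)‖ + 1)), K,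
    ⟨hB, lt_min hρ (by positivity), le_max_left _ _, ?_, ?_, ?_, ?_, ?_, ?_, ?_⟩⟩
  · calc (K : ℝ) * r ≤ K * (1 / (K + 1)) := by gcongr; exact min_le_right _ _
      _ < 1 := by rw [mul_one_div, div_lt_one (by positivity)]; linarith
  · exact fun x hx => Ring.mul_inverse_cancel _ (hball x (hsub hx)).1
  · exact fun x hx => (hball x (hsub hx)).2.1.le.trans
      ((le_max_left _ _).trans (le_max_right _ _))
  · exact fun x hx => (hball x (hsub hx)).2.2.1.le.trans
      ((le_max_right _ _).trans (le_max_right _ _))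
  · exact hK.mono fun x hx => (hball x (hsub hx)).2.2.2.2
  · exact fun x hx => (hball x (hsub hx)).2.2.2.1.1.contDiffWithinAt
  · exact fun x hx y hy hxy => hι (hWinj (hball x (hsub hx)).2.2.2.1.2
      (hball y (hsub hy)).2.2.2.1.2 hxy)

variable {ι : E →L[ℝ] A} {B : E →L[ℝ] E →L[ℝ] E} {r N : ℝ} {K : NNReal}

/-- Short Cameron–Martin paths that start near `1` lift through the exponential map. -/
lemma IsExpChart.exists_lift (h : IsExpChart ι B r N K) {g : ℝ → Aˣ} {a : ℝ → E}
    (hg : IsCMPath ι g a) {δ : ℝ} (hδ0 : 0 ≤ δ)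
    (hδ : ∫⁻ t in Icc (0 : ℝ) 1, ‖a t‖ₑ ≤ ENNReal.ofReal δ) {x₀ : E}
    (hg0 : g 0 = expUnit (ι x₀)) (hx₀ : ‖x₀‖ + N * δ < r) :
    ∃ x₁ ∈ Metric.ball (0 : E) r, g 1 = expUnit (ι x₁) ∧ ‖x₁ - x₀‖ ≤ N * δ ∧
      ‖x₁ - x₀ - Ring.inverse (omega B x₀) (∫ t in (0 : ℝ)..1, a t)‖ ≤ K * (N * δ) * δ := by
  have hN0 : 0 ≤ N := zero_le_one.trans h.one_le
  have hNδ : 0 ≤ N * δ := by positivity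
  set ψ : E → E →L[ℝ] E := fun x => Ring.inverse (omega B x) with hψ
  have haI : IntegrableOn a (Icc 0 1) :=
    ⟨hg.piecewise.aestronglyMeasurable, hδ.trans_lt ENNReal.ofReal_lt_top⟩
  -- Extension of `a` by zero, to have a driving term that is integrable on the whole line.
  set b : ℝ → E := (Icc (0 : ℝ) 1).indicator a with hb
  have hbI : Integrable b := haI.integrable_indicator measurableSet_Icc
  have hbδ : ∫ t, ‖b t‖ ≤ δ := by
    rw [integral_norm_eq_lintegral_enorm hbI.aestronglyMeasurable]
    refine ENNReal.toReal_le_of_le_ofReal hδ0 (le_trans (le_of_eq ?_) hδ)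
    rw [← lintegral_indicator measurableSet_Icc]
    exact lintegral_congr fun t => enorm_indicator_eq_indicator_enorm a t
  have hKδ : K * δ < 1 := by
    -- Since `1 ≤ N`, `δ ≤ N δ < r`; then `K δ ≤ K r < 1`.
    have : δ ≤ r := by nlinarith [h.one_le, norm_nonneg x₀]
    exact lt_of_le_of_lt (by gcongr) h.lipschitz_radius
  obtain ⟨x, hxc, hxδ, hxI, hx⟩ := exists_integral_curve h.norm_inverse_le h.lipschitz hbI hbδ hN0
    hx₀ hKδ
  have hxball : ∀ t, x t ∈ Metric.ball (0 : E) r := by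
    intro t
    rw [mem_ball_zero_iff]
    have h2 := norm_add_le (x t - x₀) x₀
    rw [sub_add_cancel] at h2
    linarith [hxδ t]
  have hx0 : x 0 = x₀ := by simpa using hx 0
  have hx₀r : x₀ ∈ Metric.ball (0 : E) r := hx0 ▸ hxball 0
  obtain ⟨S, hS⟩ := hg.hasDeriv
  obtain ⟨S', hS'⟩ := hg.piecewise.1
  -- `S` is removed to differentiate `g`, and `S'` to have `a` continuous, so that the integral
  -- defining `x` is differentiable. Elsewhere `ω(x) ω(x)⁻¹ a = a` makes the two terms of the
  -- product rule cancel.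
  have hconst := eq_of_hasDerivAt_zero_off_countable (S := S ∪ S')
    (f := fun t => NormedSpace.exp (ι (x t)) * Ring.inverse (g t : A))
    (S.finite_toSet.union S'.finite_toSet).countable
    (by
      refine (continuous_exp.comp (ι.continuous.comp hxc)).continuousOn.mul fun t ht => ?_
      exact ContinuousAt.comp_continuousWithinAt (f := fun t => (g t : A))
        (NormedRing.inverse_continuousAt (g t)) (hg.continuousOn t ht))
    (by
      intro t ht
      have htI : Icc (0 : ℝ) 1 ∈ 𝓝 t := Icc_mem_nhds ht.1.1 ht.1.2
      have htI' : t ∈ Icc (0 : ℝ) 1 := Ioo_subset_Icc_self ht.1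
      have hbt : ContinuousAt b t := by
        refine ((hS' t htI' fun hm => ht.2 (Or.inr hm)).continuousAt htI).congr ?_
        filter_upwards [htI] with s hs
        simp [hb, hs]
      have hxd : HasDerivAt x (ψ (x t) (a t)) t := by
        have h1 : ContinuousAt (fun s => ψ (x s) (b s)) t :=
          (h.contDiffOn.continuousOn.comp_continuous hxc hxball).continuousAt.clm_apply hbt
        have h2 := (intervalIntegral.integral_hasDerivAt_right hxI.intervalIntegrable
          hxI.aestronglyMeasurable.stronglyMeasurableAtFilter h1 (a := 0)).const_add x₀
        have h3 : b t = a t := by simp [hb, htI']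
        rw [h3] at h2
        exact h2.congr_of_eventuallyEq (Eventually.of_forall hx)
      have h1 := (hasFDerivAt_exp_comp ι B h.bracket (x t)).comp_hasDerivAt t hxd
      have h2 := (hasFDerivAt_ringInverse (𝕜 := ℝ) (g t)).comp_hasDerivAt t
        ((hS t htI' fun hm => ht.2 (Or.inl hm)).hasDerivAt htI)
      refine (h1.fun_mul h2).congr_deriv ?_
      have h3 : omega B (x t) (ψ (x t) (a t)) = a t := by
        rw [← mul_apply_eq_comp, h.omega_mul_inverse _ (hxball t)]; rfl
      simp [h3, mul_assoc])
  refine ⟨x 1, hxball 1, ?_, hxδ 1, ?_⟩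
  · have hg1 : NormedSpace.exp (ι (x 1)) * Ring.inverse (g 1 : A) = 1 := by
      refine hconst.trans ?_
      simp only [hx0, hg0]
      exact (congrArg _ (Ring.inverse_unit (expUnit (ι x₀)))).trans (exp_mul_exp_neg _)
    ext
    have := congrArg (· * (g 1 : A)) hg1
    change (g 1 : A) = NormedSpace.exp (ι (x 1))
    simpa [mul_assoc] using this.symm
  · have hab : ∫ t in (0 : ℝ)..1, a t = ∫ t in (0 : ℝ)..1, b t := by
      refine intervalIntegral.integral_congr fun t ht => ?_
      rw [uIcc_of_le zero_le_one] at ht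
      simp [hb, ht]
    -- The difference is `∫ (ψ (x s) - ψ x₀) (b s)`. The Lipschitz bound with `‖x s - x₀‖ ≤ N δ`
    -- gives one factor `δ`, and the integral of `‖b‖` the other.
    rw [hab, hx 1, add_sub_cancel_left, ← (ψ x₀).intervalIntegral_comp_comm hbI.intervalIntegrable,
      ← intervalIntegral.integral_sub hxI.intervalIntegrable
        ((ψ x₀).integrable_comp hbI).intervalIntegrable]
    refine intervalIntegral.norm_integral_le_integral_norm_uIoc.trans ?_
    have hc0 : 0 ≤ K * (N * δ) := by positivity
    calc _ ≤ ∫ s in uIoc (0 : ℝ) 1, K * (N * δ) * ‖b s‖ := by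
          refine integral_mono_of_nonneg (Eventually.of_forall fun _ => norm_nonneg _)
            (hbI.norm.const_mul _).restrict (Eventually.of_forall fun s => ?_)
          dsimp only
          rw [← _root_.sub_apply]
          refine ContinuousLinearMap.le_of_opNorm_le _ ?_ _
          rw [← dist_eq_norm]
          refine (h.lipschitz.dist_le_mul _ (hxball s) _ hx₀r).trans ?_
          gcongr
          rw [dist_eq_norm]
          exact hxδ s
      _ ≤ ∫ s, K * (N * δ) * ‖b s‖ := setIntegral_le_integral (hbI.norm.const_mul _)
            (Eventually.of_forall fun _ => by positivity)
      _ ≤ K * (N * δ) * δ := by rw [integral_const_mul]; gcongr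

end Lift

/-! ### The exponential map as a local homeomorphism -/

section Chart

variable {E : Type u} [NormedAddCommGroup E] [NormedSpace ℝ E]
  {A : Type v} [NormedRing A] [NormedAlgebra ℝ A]

lemma GCM.isOpen_iff {ι : E →L[ℝ] A} {U : Set (GCM ι)} :
    IsOpen U ↔ ∀ x ∈ U, ∃ ε : ℝ≥0∞, 0 < ε ∧ ∀ y : GCM ι, cmDist ι x.1 y.1 < ε → y ∈ U :=
  Iff.rfl

variable {ι : E →L[ℝ] A} {B : E →L[ℝ] E →L[ℝ] E} {r N : ℝ} {K : NNReal}

namespace IsExpChart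

lemma exists_small (h : IsExpChart ι B r N K) {x : E} (hx : x ∈ Metric.ball (0 : E) r) {ε : ℝ}
    (hε : 0 < ε) : ∃ δ > 0, ‖x‖ + N * δ < r ∧ N * δ < ε := by
  have hN : 0 < N := zero_lt_one.trans_le h.one_le
  rw [mem_ball_zero_iff] at hx
  have hm : 0 < min ε (r - ‖x‖) := lt_min hε (by linarith)
  -- The factor `2` makes both inequalities strict.
  refine ⟨min ε (r - ‖x‖) / (2 * N), by positivity, ?_⟩
  have h1 : N * (min ε (r - ‖x‖) / (2 * N)) = min ε (r - ‖x‖) / 2 := by field_simp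
  rw [h1]
  have h2 := min_le_left ε (r - ‖x‖)
  have h3 := min_le_right ε (r - ‖x‖)
  constructor <;> linarith

variable [CompleteSpace A]

lemma injOn_expCM (h : IsExpChart ι B r N K) : InjOn (expCM ι) (Metric.ball 0 r) :=
  fun _ hx _ hy hxy => h.injOn hx hy (congrArg (fun g : GCM ι => (g.1 : A)) hxy)

variable [CompleteSpace E]

/-- The segment from `x` to `y` stays in the ball by convexity, and its image under `exp` has left
derivative `ω(x + t (y - x)) (y - x)`, of norm at most `N ‖y - x‖`. -/
lemma cmDist_exp_le (h : IsExpChart ι B r N K) {x y : E} (hx : x ∈ Metric.ball (0 : E) r)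
    (hy : y ∈ Metric.ball (0 : E) r) :
    cmDist ι (expUnit (ι x)) (expUnit (ι y)) ≤ ENNReal.ofReal (N * ‖y - x‖) := by
  have hline : ∀ t : ℝ, HasDerivAt (fun t : ℝ => x + t • (y - x)) (y - x) t := fun t => by
    simpa using ((hasDerivAt_id t).smul_const (y - x)).const_add x
  have hlc : Continuous fun t : ℝ => x + t • (y - x) := by fun_prop
  have hac : Continuous fun t : ℝ => omega B (x + t • (y - x)) (y - x) :=
    ((contDiff_omega B).continuous.comp hlc).clm_apply continuous_const
  have hd : ∀ t : ℝ, HasDerivAt (fun t : ℝ => NormedSpace.exp (ι (x + t • (y - x))))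
      (NormedSpace.exp (ι (x + t • (y - x))) * ι (omega B (x + t • (y - x)) (y - x))) t := fun t => by
    have h1 := (hasFDerivAt_exp_comp ι B h.bracket (x + t • (y - x))).comp_hasDerivAt t (hline t)
    exact h1
  have hpath : IsCMPath ι (fun t => expUnit (ι (x + t • (y - x))))
      (fun t => omega B (x + t • (y - x)) (y - x)) :=
    ⟨fun t _ => (hd t).continuousAt.continuousWithinAt, ⟨∅, fun t _ _ => (hd t).hasDerivWithinAt⟩,
      ⟨∅, fun t _ _ => hac.continuousWithinAt⟩,
      fun t _ => ⟨_, hac.continuousAt.tendsto.mono_left nhdsWithin_le_nhds⟩,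
      fun t _ => ⟨_, hac.continuousAt.tendsto.mono_left nhdsWithin_le_nhds⟩⟩
  refine iInf_le_of_le _ (iInf_le_of_le _ (iInf_le_of_le ⟨hpath, by simp, by simp⟩ ?_))
  calc _ ≤ ∫⁻ _ in Icc (0 : ℝ) 1, ENNReal.ofReal (N * ‖y - x‖) := by
        refine setLIntegral_mono measurable_const fun t ht => ?_
        rw [← ofReal_norm]
        refine ENNReal.ofReal_le_ofReal (ContinuousLinearMap.le_of_opNorm_le _ ?_ _)
        exact h.norm_omega_le _ ((convex_ball (0 : E) r).add_smul_sub_mem hx hy ht)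
    _ = _ := by simp

/-- A distance below `δ` is witnessed by a path of length below `δ`; its lift ends at the required
logarithm. -/
lemma exists_eq_expCM (h : IsExpChart ι B r N K) {x : E} {y : GCM ι} {δ : ℝ} (hδ : 0 ≤ δ)
    (hx : ‖x‖ + N * δ < r) (hy : cmDist ι (expCM ι x).1 y.1 < ENNReal.ofReal δ) :
    ∃ x₁ ∈ Metric.ball (0 : E) r, expCM ι x₁ = y ∧ ‖x₁ - x‖ ≤ N * δ := by
  simp only [cmDist, iInf_lt_iff] at hy
  obtain ⟨g, a, ⟨hg, hg0, hg1⟩, hlt⟩ := hy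
  obtain ⟨x₁, hx₁, he, hn, -⟩ := h.exists_lift hg hδ hlt.le hg0 hx
  exact ⟨x₁, hx₁, Subtype.ext (he.symm.trans hg1), hn⟩

lemma continuousOn_expCM (h : IsExpChart ι B r N K) :
    ContinuousOn (expCM ι) (Metric.ball 0 r) := by
  rw [continuousOn_open_iff Metric.isOpen_ball]
  intro W hW
  rw [Metric.isOpen_iff]
  rintro x ⟨hx, hxW⟩
  obtain ⟨ε, hε, hball⟩ := GCM.isOpen_iff.1 hW _ hxW
  have hcont : ContinuousAt (fun y => ENNReal.ofReal (N * ‖y - x‖)) x :=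
    (ENNReal.continuous_ofReal.comp (by fun_prop)).continuousAt
  have hev : ∀ᶠ y in 𝓝 x, ENNReal.ofReal (N * ‖y - x‖) < ε :=
    hcont.eventually_lt continuousAt_const (by simpa using hε)
  obtain ⟨ρ, hρ, hsub⟩ := Metric.eventually_nhds_iff_ball.1
    (hev.and (Metric.isOpen_ball.mem_nhds hx))
  exact ⟨ρ, hρ, fun y hy => ⟨(hsub y hy).2,
    hball _ ((h.cmDist_exp_le hx (hsub y hy).2).trans_lt (hsub y hy).1)⟩⟩

/-- By lifting, a group element close to `exp x` has a logarithm close to `x`. This openness is the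
continuity of `log`. -/
lemma isOpen_image_expCM (h : IsExpChart ι B r N K) {O : Set E} (hO : IsOpen O)
    (hOr : O ⊆ Metric.ball 0 r) : IsOpen (expCM ι '' O) := by
  rw [GCM.isOpen_iff]
  rintro _ ⟨x, hx, rfl⟩
  obtain ⟨ε, hε, hball⟩ := Metric.isOpen_iff.1 hO x hx
  obtain ⟨δ, hδ, hδr, hδε⟩ := h.exists_small (hOr hx) hε
  refine ⟨ENNReal.ofReal δ, by simpa using hδ, fun y hy => ?_⟩
  obtain ⟨x₁, -, he, hn⟩ := h.exists_eq_expCM hδ.le hδr hy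
  exact ⟨x₁, hball (by rw [Metric.mem_ball, dist_eq_norm]; linarith), he⟩

/-- The exponential chart. -/
def chart (h : IsExpChart ι B r N K) : OpenPartialHomeomorph E (GCM ι) :=
  OpenPartialHomeomorph.ofContinuousOpenRestrict (h.injOn_expCM.toPartialEquiv (expCM ι) _)
    h.continuousOn_expCM
    (by
      rintro O ⟨O', hO', rfl⟩
      have := h.isOpen_image_expCM (hO'.inter Metric.isOpen_ball) inter_subset_right
      convert this using 1
      ext y
      constructor
      · rintro ⟨x, hx, rfl⟩
        exact ⟨x, ⟨hx, x.2⟩, rfl⟩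
      · rintro ⟨x, ⟨hx, hx'⟩, rfl⟩
        exact ⟨⟨x, hx'⟩, hx, rfl⟩)
    Metric.isOpen_ball

lemma chart_symm_expCM (h : IsExpChart ι B r N K) {x : E} (hx : x ∈ Metric.ball (0 : E) r) :
    h.chart.symm (expCM ι x) = x :=
  h.chart.left_inv hx

/-! ### Differentiability of the logarithm -/

/-- The logarithm has the differential `ω (log g)⁻¹` at `g`. -/
lemma hasLeftDifferential_chart_symm (h : IsExpChart ι B r N K) :
    HasLeftDifferential ι h.chart.symm (fun g => Ring.inverse (omega B (h.chart.symm g)))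
      h.chart.target := by
  rintro γ a ⟨hac, hγ⟩ t ht
  set x₀ := h.chart.symm (γ t) with hx₀
  have hx₀r : x₀ ∈ Metric.ball (0 : E) r := h.chart.map_target ht
  have hγt : expCM ι x₀ = γ t := h.chart.right_inv ht
  have hN0 : 0 ≤ N := zero_le_one.trans h.one_le
  set ψ := Ring.inverse (omega B x₀)
  set M := ‖a t‖ + 1 with hM
  have hM0 : 0 < M := by positivity
  have hev1 : ∀ᶠ s in 𝓝 t, ‖a s‖ < M :=
    hac.continuousAt.norm.eventually_lt continuousAt_const (by simp [hM])
  have hev2 : ∀ᶠ s in 𝓝 t, ‖x₀‖ + N * (|s - t| * M) < r :=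
    ContinuousAt.eventually_lt (by fun_prop) continuousAt_const (by simpa using hx₀r)
  -- The piece of `γ` between `t` and `s`, rescaled to `[0,1]`, is a path of length at most `δ = |s
  -- - t| M`, also for `s < t`. The second-order estimate of `exists_lift` then gives an error `K N
  -- δ²`. The lift itself shows that `γ s` lies in the chart, so continuity of `γ` for the distance
  -- need not be known beforehand.
  have hest : ∀ᶠ s in 𝓝 t,
      ‖h.chart.symm (γ s) - (x₀ + ψ (∫ τ in t..s, a τ))‖ ≤ K * N * M ^ 2 * ‖‖s - t‖ ^ 2‖ := by
    obtain ⟨ρ, hρ, hball⟩ := Metric.eventually_nhds_iff_ball.1 hev1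
    filter_upwards [hev2, Metric.ball_mem_nhds t hρ] with s hs hsρ
    have hseg : ∀ τ ∈ Icc (0 : ℝ) 1, ‖a (t + (s - t) * τ)‖ ≤ M := fun τ hτ => by
      have := (convex_ball t ρ).add_smul_sub_mem (Metric.mem_ball_self hρ) hsρ hτ
      rw [smul_eq_mul, mul_comm] at this
      exact (hball _ this).le
    have hlin : Continuous fun τ : ℝ => t + (s - t) * τ := by fun_prop
    have hbc : Continuous fun τ : ℝ => (s - t) • a (t + (s - t) * τ) :=
      (hac.comp hlin).const_smul _
    have hd : ∀ τ : ℝ, HasDerivAt (fun τ => ((γ (t + (s - t) * τ)).1 : A))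
        (((γ (t + (s - t) * τ)).1 : A) * ι ((s - t) • a (t + (s - t) * τ))) τ := by
      intro τ
      have h1 : HasDerivAt (fun τ : ℝ => t + (s - t) * τ) (s - t) τ := by
        simpa using ((hasDerivAt_id τ).const_mul (s - t)).const_add t
      simpa [Function.comp_def] using (hγ (t + (s - t) * τ)).scomp τ h1
    have hpath : IsCMPath ι (fun τ => (γ (t + (s - t) * τ)).1)
        (fun τ => (s - t) • a (t + (s - t) * τ)) :=
      ⟨fun τ _ => (hd τ).continuousAt.continuousWithinAt,
        ⟨∅, fun τ _ _ => (hd τ).hasDerivWithinAt⟩,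
        ⟨∅, fun τ _ _ => hbc.continuousWithinAt⟩,
        fun τ _ => ⟨_, hbc.continuousAt.tendsto.mono_left nhdsWithin_le_nhds⟩,
        fun τ _ => ⟨_, hbc.continuousAt.tendsto.mono_left nhdsWithin_le_nhds⟩⟩
    have hstart : (γ (t + (s - t) * 0)).1 = expUnit (ι x₀) := by
      rw [mul_zero, add_zero, ← hγt]; rfl
    obtain ⟨x₁, hx₁, he, -, hn⟩ := h.exists_lift hpath (δ := |s - t| * M) (by positivity)
      (by
        calc _ ≤ ∫⁻ _ in Icc (0 : ℝ) 1, ENNReal.ofReal (|s - t| * M) := by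
              refine setLIntegral_mono measurable_const fun τ hτ => ?_
              rw [← ofReal_norm, norm_smul, Real.norm_eq_abs]
              exact ENNReal.ofReal_le_ofReal (by gcongr; exact hseg τ hτ)
          _ = _ := by simp)
      (x₀ := x₀) hstart hs
    have hγs : γ s = expCM ι x₁ := Subtype.ext (by
      rw [mul_one, add_sub_cancel] at he; exact he)
    have hint : ∫ τ in (0 : ℝ)..1, (s - t) • a (t + (s - t) * τ) = ∫ τ in t..s, a τ := by
      rw [intervalIntegral.integral_smul, intervalIntegral.smul_integral_comp_add_mul]
      simp
    rw [hγs, h.chart_symm_expCM hx₁, ← sub_sub, ← hint]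
    refine hn.trans (le_of_eq ?_)
    rw [norm_pow, norm_norm, Real.norm_eq_abs]
    ring
  -- A function that is `O(|s - t|²)` has zero derivative at `t`; what remains is the fundamental
  -- theorem of calculus for `∫ a`.
  have hlog : HasDerivAt (fun s => h.chart.symm (γ s) - (x₀ + ψ (∫ τ in t..s, a τ))) 0 t := by
    have hO : (fun s => h.chart.symm (γ s) - (x₀ + ψ (∫ τ in t..s, a τ))) =O[𝓝 t]
        fun s => ‖s - t‖ ^ 2 := Asymptotics.IsBigO.of_bound _ hest
    have hF := Asymptotics.IsBigO.hasFDerivAt (𝕜 := ℝ) hO one_lt_two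
    simpa using hF.hasDerivAt
  have hmain : HasDerivAt (fun s => x₀ + ψ (∫ τ in t..s, a τ)) (ψ (a t)) t :=
    (ψ.hasFDerivAt.comp_hasDerivAt t (intervalIntegral.integral_hasDerivAt_right
      (hac.intervalIntegrable t t) hac.aestronglyMeasurable.stronglyMeasurableAtFilter
      hac.continuousAt)).const_add x₀
  simpa using hlog.fun_add hmain

/-- The differential of `f ∘ log` is `(Df · ω⁻¹) ∘ log`, again a smooth function of `log`. Allowing
arbitrary `f` and target `F` therefore closes the induction; the logarithm itself is the case `f =
id`. -/
lemma contDiffFrom_comp_chart_symm (h : IsExpChart ι B r N K) (n : ℕ) {F : Type u}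
    [NormedAddCommGroup F] [NormedSpace ℝ F] {f : E → F}
    (hf : ContDiffOn ℝ ((⊤ : ℕ∞) : WithTop ℕ∞) f (Metric.ball 0 r)) :
    ContDiffFrom ι n (fun g => f (h.chart.symm g)) h.chart.target := by
  induction n generalizing F with
  | zero => exact hf.continuousOn.comp h.chart.continuousOn_symm h.chart.mapsTo_symm
  | succ n ih =>
    refine ⟨hf.continuousOn.comp h.chart.continuousOn_symm h.chart.mapsTo_symm,
      fun g => (fderiv ℝ f (h.chart.symm g)).comp (Ring.inverse (omega B (h.chart.symm g))),
      fun γ a hγ t ht => ?_, ?_⟩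
    · have hx : h.chart.symm (γ t) ∈ Metric.ball (0 : E) r := h.chart.map_target ht
      have hfd : DifferentiableAt ℝ f (h.chart.symm (γ t)) :=
        (hf.contDiffAt (Metric.isOpen_ball.mem_nhds hx)).differentiableAt (by simp)
      have := hfd.hasFDerivAt.comp_hasDerivAt t (h.hasLeftDifferential_chart_symm γ a hγ t ht)
      exact this
    · exact ih (f := fun x => (fderiv ℝ f x).comp (Ring.inverse (omega B x)))
        ((hf.fderiv_of_isOpen Metric.isOpen_ball (by simp)).clm_comp h.contDiffOn)

end IsExpChart

variable [CompleteSpace E] [CompleteSpace A]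

/-- For a Banach Lie algebra that is continuously embedded in a Banach algebra, the exponential map
is a local diffeomorphism into the Cameron–Martin group. -/
theorem exists_exp_chart (ι : E →L[ℝ] A) (hι : Function.Injective ι) (B : E →L[ℝ] E →L[ℝ] E)
    (hB : ∀ x y, ι (B x y) = ι x * ι y - ι y * ι x) :
    ∃ e : OpenPartialHomeomorph E (GCM ι), 0 ∈ e.source ∧ (∀ x ∈ e.source, e x = expCM ι x) ∧
      SmoothInto ι (expCM ι) e.source ∧ SmoothFrom ι e.symm e.target := by
  obtain ⟨r, N, K, h⟩ := exists_isExpChart ι hι B hB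
  exact ⟨h.chart, Metric.mem_ball_self h.radius_pos, fun _ _ => rfl,
    ⟨h.continuousOn_expCM, omega B, (contDiff_omega B).contDiffOn,
      fun x _ => hasFDerivAt_exp_comp ι B hB x⟩,
    fun n => h.contDiffFrom_comp_chart_symm n contDiffOn_id⟩

/-- A bounded bracket, given by its values in the ambient algebra, as a continuous bilinear map. -/
lemma exists_bracket {E : Type u} [NormedAddCommGroup E] [NormedSpace ℝ E]
    {A : Type v} [NormedRing A] [NormedAlgebra ℝ A]
    (ι : E →L[ℝ] A) (hι : Function.Injective ι) (C : ℝ)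
    (hbracket : ∀ x y : E, ∃ z : E, ι z = ι x * ι y - ι y * ι x ∧ ‖z‖ ≤ C * ‖x‖ * ‖y‖) :
    ∃ B : E →L[ℝ] E →L[ℝ] E, ∀ x y, ι (B x y) = ι x * ι y - ι y * ι x := by
  choose b hb hbC using hbracket
  refine ⟨LinearMap.mkContinuous₂ (LinearMap.mk₂ ℝ b ?_ ?_ ?_ ?_) C hbC, hb⟩
  all_goals
    -- Linearity of the bracket in each variable is checked after applying the injective `ι`, where
    -- it is linearity of the commutator.
    intros
    apply hι
    simp only [hb, map_add, map_smul, add_mul, mul_add, smul_mul_assoc, mul_smul_comm, smul_sub]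
    try abel

end Chart

end CameronMartin

end

theorem theorem3p1 {𝕜 : Type*} [RCLike 𝕜] {H : Type*} [NormedAddCommGroup H]
    [InnerProductSpace 𝕜 H] [CompleteSpace H] [TopologicalSpace.SeparableSpace H]
    {E : Type*} [NormedAddCommGroup E] [InnerProductSpace ℝ E] [CompleteSpace E]
    (ι : E →L[ℝ] (H →L[𝕜] H)) (hι : Function.Injective ι)
    (C : ℝ) (hC : 0 < C)
    (hbracket : ∀ x y : E, ∃ z : E, ι z = ι x * ι y - ι y * ι x ∧ ‖z‖ ≤ C * ‖x‖ * ‖y‖) :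
    ∃ e : OpenPartialHomeomorph E (CameronMartin.GCM ι),
      0 ∈ e.source ∧
      (∀ x ∈ e.source, e x = CameronMartin.expCM ι x) ∧
      CameronMartin.SmoothInto ι (CameronMartin.expCM ι) e.source ∧
      CameronMartin.SmoothFrom ι e.symm e.target := by
  obtain ⟨B, hB⟩ := CameronMartin.exists_bracket ι hι C hbracket
  exact CameronMartin.exists_exp_chart ι hι B hB
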